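/- Let $d\ge 1$ and let $k:\mathbb R^d\times\mathbb R^d\to\mathbb R$ be a (positive semidefinite) kernel with reproducing kernel Hilbert space $\mathcal H_k$. Assume that $k$ is twice continuously differentiable on $\mathbb R^d\times\mathbb R^d$, bounded ($\sup_x \sqrt{k(x,x)}<\infty$), translation-invariant ($k(x,y)=\kappa(x-y)$ for some function $\kappa$), and characteristic (the mean embedding $P\mapsto\int k(\cdot,x)\,dP(x)\in\mathcal H_k$ is injective on Borel probability measures on $\mathbb R^d$). Let $\mathcal T$ be the set of Borel probability measures $P_0$ on $\mathbb R^d$ that have a Lebesgue density $p_0$ which is continuously differentiable, satisfies $p_0>0$ everywhere, and for which $\lim_{\|x\|_2\to\infty}h(x)p_0(x)=0$ for all $h\in\mathcal H_k$. For $P_0\in\mathcal T$ put, for $f=(f_j)_{j=1}^d\in\mathcal H_k^d$, $$(\mathcal A_{p_0}f)(x)=\langle\nabla \ln p_0(x),f(x)\rangle+\sum_{j=1}^d\frac{\partial f_j}{\partial x_j}(x),$$ $$\mathrm{KSD}(P_0,P)=\sup_{\|f\|_{\mathcal H_k^d}\le 1}\bigl|\mathbb E_{P_0}[\mathcal A_{p_0}f]-\mathbb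 E_P[\mathcal A_{p_0}f]\bigr|,$$ where $\mathbb E_{P_0}[\mathcal A_{p_0}f]$ is read as $0$ if $\mathcal A_{p_0}f$ is not $P_0$-integrable. Let $$K_0(x,y)=\langle\nabla\ln p_0(x),\nabla\ln p_0(y)\rangle k(x,y)+\langle\nabla\ln p_0(y),\nabla_xk(x,y)\rangle+\langle\nabla\ln p_0(x),\nabla_yk(x,y)\rangle+\sum_{j=1}^d\frac{\partial^2k(x,y)}{\partial x_j\partial y_j},$$ and let $\mathcal S_{P_0}$ be the set of all Borel probability measures $P$ on $\mathbb R^d$ with $\mathbb E_P\sqrt{K_0(X,X)}<\infty$. Then there is a constant $c>0$ (not depending on $n$) such that for every integer $n\ge1$ $$\inf_{\hat F_n}\ \sup_{P_0\in\mathcal T}\ \sup_{P\in\mathcal S_{P_0}}P^n\!\left(\bigl|\hat F_n(X_1,\dots,X_n)-\mathrm{KSD}(P_0,P)\bigr|\ge\frac{c}{\sqrt n}\right)\ \ge\ \frac14\ >0,$$ where the infimum is over all measurable functions $\hat F_n:(\mathbb R^d)^n\to\mathbb R$. In particular, the minimax risk satisfies $$R_n^*=\inf_{\hat F_n}\ \sup_{P_0\in\mathcal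 T}\ \sup_{P\in\mathcal S_{P_0}}\mathbb E_{P^n}\bigl|\hat F_n(X_1,\dots,X_n)-\mathrm{KSD}(P_0,P)\bigr|\ \ge\ \frac{c}{4\sqrt n}.$$ -/

import Mathlib

open MeasureTheory Filter Topology

noncomputable section

namespace SteinDisc

/-- `ℝ^d` with the Euclidean norm. -/
abbrev Rd (d : ℕ) : Type := EuclideanSpace ℝ (Fin d)

/-- The partial derivative `∂g/∂x_j` at `x`, i.e. the derivative at `t = 0` of `g (x + t e_j)`. -/
def pderiv {d : ℕ} (j : Fin d) (g : Rd d → ℝ) (x : Rd d) : ℝ :=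
  lineDeriv ℝ g x (EuclideanSpace.single j 1)

/-- The `j`-th coordinate of the score `∇ ln p₀` at `x`. -/
def score {d : ℕ} (p₀ : Rd d → ℝ) (j : Fin d) (x : Rd d) : ℝ :=
  pderiv j (fun z => Real.log (p₀ z)) x

/-- The Stein kernel
`K₀(x,y) = ⟨∇ ln p₀(x), ∇ ln p₀(y)⟩ k(x,y) + ⟨∇ ln p₀(y), ∇_x k(x,y)⟩
  + ⟨∇ ln p₀(x), ∇_y k(x,y)⟩ + ∑_j ∂²k(x,y)/∂x_j∂y_j`. -/
def steinKernel {d : ℕ} (k : Rd d → Rd d → ℝ) (p₀ : Rd d → ℝ) (x y : Rd d) : ℝ :=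
  (∑ j, score p₀ j x * score p₀ j y) * k x y
    + ∑ j, score p₀ j y * pderiv j (fun x' => k x' y) x
    + ∑ j, score p₀ j x * pderiv j (fun y' => k x y') y
    + ∑ j, pderiv j (fun x' => pderiv j (fun y' => k x' y') y) x

/-- The kernel `k` is bounded: `sup_x √k(x,x) < ∞`. -/
def IsBoundedKernel {d : ℕ} (k : Rd d → Rd d → ℝ) : Prop :=
  BddAbove (Set.range fun x => √(k x x))

/-- The kernel `k` is translation invariant: `k(x,y) = κ(x - y)` for some `κ`. -/
def IsTranslationInvariant {d : ℕ} (k : Rd d → Rd d → ℝ) : Prop :=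
  ∃ κ : Rd d → ℝ, ∀ x y, k x y = κ (x - y)

section RKHSdefs

variable {d : ℕ} (H : Type*) [NormedAddCommGroup H] [InnerProductSpace ℝ H]
  [RKHS ℝ H (Rd d) ℝ]

/-- `k` is the reproducing kernel of the Hilbert space of functions `H`, i.e. `H = H_k`:
for every `y` the function `k(·,y)` is (the function of) the element of `H` that represents the
evaluation at `y`. -/
def IsKernelOf [CompleteSpace H] (k : Rd d → Rd d → ℝ) : Prop :=
  ∀ x y, RKHS.kerFun H y (1 : ℝ) x = k x y

/-- The kernel of `H` is characteristic: the mean embedding `P ↦ ∫ k(·,x) dP(x) ∈ H` is injective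
on the Borel probability measures on `ℝ^d`. -/
def IsCharacteristic [CompleteSpace H] : Prop :=
  ∀ P Q : Measure (Rd d), IsProbabilityMeasure P → IsProbabilityMeasure Q →
    ∫ x, RKHS.kerFun H x (1 : ℝ) ∂P = ∫ x, RKHS.kerFun H x (1 : ℝ) ∂Q → P = Q

/-- `P₀` is an admissible target with density `p₀`: a probability measure with positive,
continuously differentiable Lebesgue density `p₀` such that `h(x) p₀(x) → 0` as `‖x‖ → ∞`
for all `h ∈ H`. -/
structure IsTarget (P₀ : Measure (Rd d)) (p₀ : Rd d → ℝ) : Prop where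
  isProb : IsProbabilityMeasure P₀
  density : P₀ = (volume : Measure (Rd d)).withDensity (fun x => ENNReal.ofReal (p₀ x))
  contDiff : ContDiff ℝ 1 p₀
  pos : ∀ x, 0 < p₀ x
  vanish : ∀ h : H, Tendsto (fun x => h x * p₀ x) (Bornology.cobounded (Rd d)) (𝓝 0)

variable {H} in
/-- The Langevin–Stein operator
`(A_{p₀} f)(x) = ⟨∇ ln p₀(x), f(x)⟩ + ∑_j ∂f_j(x)/∂x_j`, for `f = (f_j)_j ∈ H^d`. -/
def langevinStein (p₀ : Rd d → ℝ) (f : PiLp 2 (fun _ : Fin d => H)) (x : Rd d) : ℝ :=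
  ∑ j, score p₀ j x * f j x + ∑ j, pderiv j (fun z => f j z) x

/-- The kernel Stein discrepancy of `P₀` (with density `p₀`) and `P`:
`sup |E_{P₀}[A_{p₀} f] - E_P[A_{p₀} f]|` over the unit ball of the product space `H^d`. -/
def ksd (P₀ : Measure (Rd d)) (p₀ : Rd d → ℝ) (P : Measure (Rd d)) : ℝ :=
  ⨆ f : {f : PiLp 2 (fun _ : Fin d => H) // ‖f‖ ≤ 1},
    |∫ x, langevinStein p₀ f.1 x ∂P₀ - ∫ x, langevinStein p₀ f.1 x ∂P|

end RKHSdefs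

/-- The class of sampling distributions for the target density `p₀`: all Borel probability
measures `P` with `E_P √K₀(X,X) < ∞`. -/
def samplingClass {d : ℕ} (k : Rd d → Rd d → ℝ) (p₀ : Rd d → ℝ) : Set (Measure (Rd d)) :=
  {P | IsProbabilityMeasure P ∧ ∫⁻ x, ENNReal.ofReal (√(steinKernel k p₀ x x)) ∂P < ⊤}

section Minimax

variable {d : ℕ} (H : Type*) [NormedAddCommGroup H] [InnerProductSpace ℝ H]
  [RKHS ℝ H (Rd d) ℝ]

/-- The minimax probability
`inf_F sup_{P₀} sup_P P^n (|F(X_1,…,X_n) - KSD(P₀,P)| ≥ s)`, where `F` runs over all measurable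
functions of the `n` observations. -/
def minimaxProb (k : Rd d → Rd d → ℝ) (n : ℕ) (s : ℝ) : ENNReal :=
  ⨅ (F : (Fin n → Rd d) → ℝ) (_ : Measurable F),
    ⨆ (P₀ : Measure (Rd d)) (p₀ : Rd d → ℝ) (_ : IsTarget H P₀ p₀)
      (P : Measure (Rd d)) (_ : P ∈ samplingClass k p₀),
      (Measure.pi fun _ : Fin n => P) {X | s ≤ |F X - ksd H P₀ p₀ P|}

/-- The minimax risk `inf_F sup_{P₀} sup_P E_{P^n} |F(X_1,…,X_n) - KSD(P₀,P)|` (possibly `∞`). -/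
def minimaxRisk (k : Rd d → Rd d → ℝ) (n : ℕ) : ENNReal :=
  ⨅ (F : (Fin n → Rd d) → ℝ) (_ : Measurable F),
    ⨆ (P₀ : Measure (Rd d)) (p₀ : Rd d → ℝ) (_ : IsTarget H P₀ p₀)
      (P : Measure (Rd d)) (_ : P ∈ samplingClass k p₀),
      ∫⁻ X, ENNReal.ofReal |F X - ksd H P₀ p₀ P| ∂(Measure.pi fun _ : Fin n => P)

end Minimax

end SteinDisc

end

/-!
The bound follows from Le Cam's two-point method with a single target. Take `P₀` with the Cauchy-type
density `p₀ ∝ (1 + ‖x‖²)^(-d)`. Its score is bounded, and translation invariance of the kernel makes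
the elements of `H`, and their partial derivatives, uniformly bounded by a multiple of the norm
(`exists_abs_pderiv_le`). Hence `A_{p₀} f` is bounded uniformly over the unit ball of `H^d`
(`exists_abs_langevinStein_le`), `K₀(x,x)` is bounded, and every probability measure belongs to the
sampling class (`mem_samplingClass`).

The discrepancy `KSD(P₀, P₀)` is `0`. The alternative is `P_ε = (1 + ε g) P₀` with `|g| ≤ 1` and
`∫ g dP₀ = 0`. Along this family the discrepancy grows linearly: for `f` in the unit ball,
`KSD(P₀, P_ε) ≥ ε |∫ g · A_{p₀} f dP₀|`. The right side is positive if `g` is the centred and rescaled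
function `A_{p₀} f` and this function is not constant (`exists_direction`). For `f` a normalised
kernel section in one coordinate direction `e_j`, a constant value `C` would mean
`∂_j (f_j p₀) = C p₀`, so that `f_j p₀` is monotone along lines and vanishes at infinity, hence is `0`
(`eq_zero_of_stein_const`); but a characteristic kernel does not vanish on the diagonal
(`apply_zero_pos`).

For `ε = 1 / (3 √n)` the chi-square divergence of `P_ε^n` from `P₀^n` is at most `1/4`, so no test
separates the two (`quarter_le_pi_tilt_compl`), while the two values of the discrepancy are at
least `2 c / √n` apart for a constant `c`. An estimator therefore errs by `c / √n` with probability
at least `1/4` under one of the two measures, and Markov's inequality gives the bound on the risk.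
-/

namespace SteinDisc

/-! ### Le Cam's two-point bound for a density perturbation -/

section TwoPoint

lemma one_add_mul_nonneg {Ω : Type*} {g : Ω → ℝ} {ε : ℝ} (hg1 : ∀ x, |g x| ≤ 1) (hε0 : 0 ≤ ε)
    (hε1 : ε ≤ 1) (x : Ω) : 0 ≤ 1 + ε * g x := by
  have := neg_le_of_abs_le (hg1 x)
  nlinarith

variable {Ω : Type*} [MeasurableSpace Ω]

/-- The product of measures with density `w` has density `∏ i, w (x i)`. -/
lemma pi_withDensity_ofReal {ι : Type*} [Fintype ι] (P : Measure Ω) [IsProbabilityMeasure P]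
    {w : Ω → ℝ} (hw : Integrable w P) (hw0 : ∀ x, 0 ≤ w x)
    [SigmaFinite (P.withDensity fun x => ENNReal.ofReal (w x))] :
    (Measure.pi fun _ : ι => P.withDensity fun x => ENNReal.ofReal (w x)) =
      (Measure.pi fun _ : ι => P).withDensity fun x => ENNReal.ofReal (∏ i, w (x i)) := by
  refine Measure.pi_eq fun s hs => ?_
  rw [withDensity_apply _ (MeasurableSet.univ_pi hs), Measure.restrict_pi_pi,
    ← ofReal_integral_eq_lintegral_ofReal
      (Integrable.fintype_prod fun i => hw.restrict)
      (Eventually.of_forall fun x => Finset.prod_nonneg fun i _ => hw0 _),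
    integral_fintype_prod_eq_prod (fun _ => w),
    ENNReal.ofReal_prod_of_nonneg fun i _ => integral_nonneg hw0]
  refine Finset.prod_congr rfl fun i _ => ?_
  rw [withDensity_apply _ (hs i), ofReal_integral_eq_lintegral_ofReal hw.restrict
    (Eventually.of_forall hw0)]

/-- The perturbation of `P` with density `1 + ε g`. -/
noncomputable def tilt (P : Measure Ω) (g : Ω → ℝ) (ε : ℝ) : Measure Ω :=
  P.withDensity fun x => ENNReal.ofReal (1 + ε * g x)

variable {P : Measure Ω} [IsProbabilityMeasure P] {g : Ω → ℝ} {ε : ℝ}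

lemma integrable_of_abs_le (hg : Measurable g) {C : ℝ} (hg1 : ∀ x, |g x| ≤ C) :
    Integrable g P :=
  Integrable.of_bound hg.aestronglyMeasurable C (Eventually.of_forall hg1)

lemma isProbabilityMeasure_tilt (hg : Measurable g) (hg1 : ∀ x, |g x| ≤ 1)
    (hg0 : ∫ x, g x ∂P = 0) (hε0 : 0 ≤ ε) (hε1 : ε ≤ 1) :
    IsProbabilityMeasure (tilt P g ε) := by
  have hi : Integrable g P := integrable_of_abs_le hg hg1
  have hw : Integrable (fun x => 1 + ε * g x) P := (integrable_const 1).add (hi.const_mul ε)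
  constructor
  rw [tilt, withDensity_apply _ MeasurableSet.univ, Measure.restrict_univ,
    ← ofReal_integral_eq_lintegral_ofReal hw
      (Eventually.of_forall (one_add_mul_nonneg hg1 hε0 hε1)),
    integral_add (integrable_const 1) (hi.const_mul ε), integral_const_mul, hg0]
  simp

lemma integral_tilt (hg : Measurable g) (hg1 : ∀ x, |g x| ≤ 1) (hε0 : 0 ≤ ε) (hε1 : ε ≤ 1)
    {a : Ω → ℝ} (ha : Measurable a) {B : ℝ} (haB : ∀ x, |a x| ≤ B) :
    ∫ x, a x ∂(tilt P g ε) = ∫ x, a x ∂P + ε * ∫ x, g x * a x ∂P := by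
  have hga : Integrable (fun x => g x * a x) P :=
    (integrable_of_abs_le ha haB).bdd_mul hg.aestronglyMeasurable (Eventually.of_forall hg1)
  rw [tilt, integral_withDensity_eq_integral_toReal_smul (by fun_prop)
    (Eventually.of_forall fun x => ENNReal.ofReal_lt_top), ← integral_const_mul,
    ← integral_add (integrable_of_abs_le ha haB) (hga.const_mul ε)]
  refine integral_congr_ae (Eventually.of_forall fun x => ?_)
  simp only [ENNReal.toReal_ofReal (one_add_mul_nonneg hg1 hε0 hε1 x), smul_eq_mul]
  ring

/-- **Le Cam's two-point bound.** If `n ε²` is small, a test based on `n` observations cannot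
distinguish `P` from its perturbation with density `1 + ε g`. The likelihood ratio `L` of the two
product measures has chi-square divergence `∫ (L - 1)² = (1 + ε² ∫ g²)ⁿ - 1 ≤ 1/4`. -/
theorem quarter_le_pi_tilt_compl (hg : Measurable g) (hg1 : ∀ x, |g x| ≤ 1)
    (hg0 : ∫ x, g x ∂P = 0) (hε0 : 0 ≤ ε) (hε1 : ε ≤ 1) {n : ℕ} (hn : n * ε ^ 2 ≤ 1 / 9)
    {S : Set (Fin n → Ω)} (hS : MeasurableSet S)
    (hPS : (Measure.pi fun _ : Fin n => P) S ≤ 1 / 4) :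
    1 / 4 ≤ (Measure.pi fun _ : Fin n => tilt P g ε) Sᶜ := by
  have := isProbabilityMeasure_tilt hg hg1 hg0 hε0 hε1
  set μ := Measure.pi fun _ : Fin n => P with hμ
  set ν := Measure.pi fun _ : Fin n => tilt P g ε with hν
  set L : (Fin n → Ω) → ℝ := fun x => ∏ i, (1 + ε * g (x i)) with hL
  have hi : Integrable g P := integrable_of_abs_le hg hg1
  have hw : Integrable (fun x => 1 + ε * g x) P := (integrable_const 1).add (hi.const_mul ε)
  have hw0 := one_add_mul_nonneg hg1 hε0 hε1
  have hLi : Integrable L μ := Integrable.fintype_prod fun i => hw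
  have hL0 : ∀ x, 0 ≤ L x := fun x => Finset.prod_nonneg fun i _ => hw0 _
  have hνμ : ν = μ.withDensity fun x => ENNReal.ofReal (L x) := by
    have : SigmaFinite (P.withDensity fun x => ENNReal.ofReal (1 + ε * g x)) := by
      change SigmaFinite (tilt P g ε); infer_instance
    exact pi_withDensity_ofReal P hw hw0
  have hg2 : Integrable (fun x => g x ^ 2) P :=
    integrable_of_abs_le (C := 1) (hg.pow_const 2) fun x => by
      rw [abs_pow]; exact pow_le_one₀ (abs_nonneg _) (hg1 x)
  have hw2e : (fun x => (1 + ε * g x) ^ 2) = fun x => 1 + (2 * ε * g x + ε ^ 2 * g x ^ 2) := by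
    funext x; ring
  have hw2' : Integrable (fun x => 2 * ε * g x + ε ^ 2 * g x ^ 2) P :=
    (hi.const_mul _).add (hg2.const_mul _)
  have hw2 : Integrable (fun x => (1 + ε * g x) ^ 2) P := by
    rw [hw2e]
    exact (integrable_const 1).add hw2'
  have hL2e : (fun x => L x ^ 2) = fun x => ∏ i, (1 + ε * g (x i)) ^ 2 := by
    funext x; simp [hL, Finset.prod_pow]
  have hL2i : Integrable (fun x => L x ^ 2) μ := by
    rw [hL2e]; exact Integrable.fintype_prod (f := fun _ y => (1 + ε * g y) ^ 2) fun i => hw2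
  have hL1 : ∫ x, L x ∂μ = 1 := by
    rw [hμ, hL, integral_fintype_prod_eq_prod (fun _ y => 1 + ε * g y),
      integral_add (integrable_const 1) (hi.const_mul ε), integral_const_mul, hg0]
    simp
  have hg2le : ∫ x, g x ^ 2 ∂P ≤ 1 := by
    calc ∫ x, g x ^ 2 ∂P ≤ ∫ x, (1 : ℝ) ∂P := integral_mono hg2 (integrable_const 1) fun x => by
          simpa using (sq_le_one_iff_abs_le_one (g x)).2 (hg1 x)
      _ = 1 := by simp
  have hL2 : ∫ x, L x ^ 2 ∂μ ≤ 5 / 4 := by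
    have h1 : ∫ x, (1 + ε * g x) ^ 2 ∂P = 1 + ε ^ 2 * ∫ x, g x ^ 2 ∂P := by
      rw [hw2e, integral_add (integrable_const 1) hw2',
        integral_add (hi.const_mul _) (hg2.const_mul _), integral_const_mul, integral_const_mul,
        hg0]
      simp
    rw [hL2e, hμ, integral_fintype_prod_eq_prod (fun _ y => (1 + ε * g y) ^ 2)]
    simp only [h1, Finset.prod_const, Finset.card_univ, Fintype.card_fin]
    have h2 : 0 ≤ ∫ x, g x ^ 2 ∂P := integral_nonneg fun x => sq_nonneg _
    calc (1 + ε ^ 2 * ∫ x, g x ^ 2 ∂P) ^ n ≤ (Real.exp (ε ^ 2)) ^ n := by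
          gcongr
          nlinarith [Real.add_one_le_exp (ε ^ 2), sq_nonneg ε]
      _ = Real.exp (n * ε ^ 2) := by rw [← Real.exp_nat_mul]
      _ ≤ Real.exp (1 / 9) := by gcongr
      _ ≤ 1 / (1 - 1 / 9) := Real.exp_bound_div_one_sub_of_interval (by norm_num) (by norm_num)
      _ ≤ 5 / 4 := by norm_num
  have hμS : μ.real S ≤ 1 / 4 := by
    rw [Measure.real]
    exact ENNReal.toReal_le_of_le_ofReal (by norm_num) (hPS.trans_eq (by
      rw [ENNReal.ofReal_div_of_pos (by norm_num)]; simp))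
  have hνS : ν.real S = ∫ x in S, L x ∂μ := by
    rw [Measure.real, hνμ, withDensity_apply _ hS,
      ← ofReal_integral_eq_lintegral_ofReal hLi.restrict (Eventually.of_forall hL0),
      ENNReal.toReal_ofReal (integral_nonneg hL0)]
  have hq' : Integrable (fun x => L x ^ 2 - 2 * L x) μ := hL2i.sub (hLi.const_mul 2)
  have hq : Integrable (fun x => L x ^ 2 - 2 * L x + 1) μ := hq'.add (integrable_const 1)
  have hνS' : ν.real S ≤ 3 / 4 := by
    rw [hνS]
    -- `L ≤ 5/4 + (L - 1)²` pointwise replaces the Cauchy-Schwarz inequality.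
    calc ∫ x in S, L x ∂μ
        ≤ ∫ x in S, (5 / 4 + (L x ^ 2 - 2 * L x + 1)) ∂μ := by
          refine integral_mono hLi.restrict ((integrable_const _).add hq.restrict) fun x => ?_
          simp only
          nlinarith [sq_nonneg (L x - 1 - 1 / 2)]
      _ = 5 / 4 * μ.real S + ∫ x in S, (L x ^ 2 - 2 * L x + 1) ∂μ := by
          rw [integral_add (integrable_const _) hq.restrict]
          simp [mul_comm]
      _ ≤ 5 / 4 * μ.real S + ∫ x, (L x ^ 2 - 2 * L x + 1) ∂μ := by
          refine add_le_add le_rfl (setIntegral_le_integral hq (Eventually.of_forall fun x => ?_))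
          simp only [Pi.zero_apply]
          nlinarith [sq_nonneg (L x - 1)]
      _ ≤ 5 / 4 * (1 / 4) + (5 / 4 - 2 + 1) := by
          rw [integral_add hq' (integrable_const 1),
            integral_sub hL2i (hLi.const_mul 2), integral_const_mul, hL1]
          simp only [integral_const, probReal_univ, smul_eq_mul]
          linarith
      _ ≤ 3 / 4 := by norm_num
  have hc : ν.real Sᶜ = 1 - ν.real S := probReal_compl_eq_one_sub hS
  have h4 : (1 / 4 : ℝ) ≤ ν.real Sᶜ := by linarith
  rw [show (1 / 4 : ENNReal) = ENNReal.ofReal (1 / 4) by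
    rw [ENNReal.ofReal_div_of_pos (by norm_num)]; simp]
  exact ENNReal.ofReal_le_of_le_toReal h4

end TwoPoint

/-! ### Translation-invariant kernels and the Stein operator -/

section Translation

lemma ksd_self {d : ℕ} (H : Type*) [NormedAddCommGroup H] [InnerProductSpace ℝ H]
    [RKHS ℝ H (Rd d) ℝ] (P₀ : Measure (Rd d)) (p₀ : Rd d → ℝ) : ksd H P₀ p₀ P₀ = 0 := by
  simp [ksd]

variable {d : ℕ} {H : Type*} [NormedAddCommGroup H] [InnerProductSpace ℝ H]
  [RKHS ℝ H (Rd d) ℝ]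

lemma bddAbove_range_ksd {p₀ : Rd d → ℝ} {B : ℝ} (hB : ∀ (f : PiLp 2 (fun _ : Fin d => H)),
      ‖f‖ ≤ 1 → ∀ x, |langevinStein p₀ f x| ≤ B)
    (P₀ P : Measure (Rd d)) [IsProbabilityMeasure P₀] [IsProbabilityMeasure P] :
    BddAbove (Set.range fun f : {f : PiLp 2 (fun _ : Fin d => H) // ‖f‖ ≤ 1} =>
      |∫ x, langevinStein p₀ f.1 x ∂P₀ - ∫ x, langevinStein p₀ f.1 x ∂P|) := by
  refine ⟨B + B, ?_⟩
  rintro _ ⟨f, rfl⟩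
  have h : ∀ Q : Measure (Rd d), IsProbabilityMeasure Q →
      |∫ x, langevinStein p₀ f.1 x ∂Q| ≤ B := fun Q _ => by
    simpa using norm_integral_le_of_norm_le (μ := Q) (f := langevinStein p₀ f.1)
      (integrable_const B) (Eventually.of_forall (hB f.1 f.2))
  exact (abs_sub _ _).trans (add_le_add (h P₀ inferInstance) (h P inferInstance))

variable [CompleteSpace H] {k : Rd d → Rd d → ℝ} {κ : Rd d → ℝ}

lemma inner_kerFun_one (f : H) (x : Rd d) : inner ℝ f (RKHS.kerFun H x (1 : ℝ)) = f x := by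
  simp

lemma norm_kerFun_one_sq (hk : IsKernelOf H k) (hκ : ∀ x y, k x y = κ (x - y)) (x : Rd d) :
    ‖RKHS.kerFun H x (1 : ℝ)‖ ^ 2 = κ 0 := by
  rw [← real_inner_self_eq_norm_sq, inner_kerFun_one, hk, hκ, sub_self]

lemma norm_kerFun_one (hk : IsKernelOf H k) (hκ : ∀ x y, k x y = κ (x - y)) (x : Rd d) :
    ‖RKHS.kerFun H x (1 : ℝ)‖ = √(κ 0) := by
  rw [← norm_kerFun_one_sq hk hκ x, Real.sqrt_sq (norm_nonneg _)]

lemma abs_apply_le (hk : IsKernelOf H k) (hκ : ∀ x y, k x y = κ (x - y)) (f : H) (x : Rd d) :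
    |f x| ≤ ‖f‖ * √(κ 0) := by
  rw [← inner_kerFun_one, ← norm_kerFun_one hk hκ x]
  exact abs_real_inner_le_norm _ _

lemma le_apply_zero (hk : IsKernelOf H k) (hκ : ∀ x y, k x y = κ (x - y)) (u : Rd d) :
    κ u ≤ κ 0 := by
  have h := abs_apply_le hk hκ (RKHS.kerFun H 0 (1 : ℝ)) u
  rw [hk, hκ, sub_zero, norm_kerFun_one hk hκ, ← sq,
    Real.sq_sqrt (by rw [← norm_kerFun_one_sq hk hκ 0]; positivity)] at h
  exact (le_abs_self _).trans h

lemma norm_kerFun_one_sub_sq (hk : IsKernelOf H k) (hκ : ∀ x y, k x y = κ (x - y)) (x y : Rd d) :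
    ‖RKHS.kerFun H x (1 : ℝ) - RKHS.kerFun H y (1 : ℝ)‖ ^ 2 = 2 * (κ 0 - κ (y - x)) := by
  rw [norm_sub_sq_real, inner_kerFun_one, norm_kerFun_one_sq hk hκ, norm_kerFun_one_sq hk hκ,
    hk, hκ]
  ring

lemma contDiff_of_kernel {m : ℕ∞}
    (hC : ContDiff ℝ m (fun z : Rd d × Rd d => k z.1 z.2)) (hκ : ∀ x y, k x y = κ (x - y)) :
    ContDiff ℝ m κ := by
  have : κ = (fun z : Rd d × Rd d => k z.1 z.2) ∘ fun u => (u, 0) := by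
    funext u; simp [hκ]
  rw [this]
  exact hC.comp (by fun_prop)

/-- A `C²` function deviates at most quadratically from its value at a local maximum. -/
lemma exists_abs_sub_le_sq_of_isLocalMax {E : Type*} [NormedAddCommGroup E] [NormedSpace ℝ E]
    {f : E → ℝ} (hf : ContDiff ℝ 2 f) {x₀ : E} (hm : IsLocalMax f x₀) :
    ∃ C : ℝ, 0 ≤ C ∧ ∀ᶠ u in 𝓝 x₀, |f u - f x₀| ≤ C * ‖u - x₀‖ ^ 2 := by
  have h1 : ContDiff ℝ 1 (fderiv ℝ f) := hf.fderiv_right (by norm_num)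
  obtain ⟨K, t, ht, hK⟩ := (h1.contDiffAt (x := x₀)).exists_lipschitzOnWith
  obtain ⟨r, hr, hrt⟩ := Metric.mem_nhds_iff.1 ht
  refine ⟨K, K.2, ?_⟩
  filter_upwards [Metric.ball_mem_nhds x₀ hr] with u hu
  have hb : ∀ z ∈ Metric.closedBall x₀ ‖u - x₀‖, ‖fderiv ℝ f z‖ ≤ K * ‖u - x₀‖ := by
    intro z hz
    have hzu : ‖z - x₀‖ ≤ ‖u - x₀‖ := by simpa [dist_eq_norm] using hz
    have hzt : z ∈ t := hrt (by
      rw [Metric.mem_ball, dist_eq_norm] at hu ⊢; exact hzu.trans_lt hu)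
    have h := hK.norm_sub_le hzt (hrt (Metric.mem_ball_self hr))
    rw [hm.fderiv_eq_zero, sub_zero] at h
    exact h.trans (by gcongr)
  have h := (convex_closedBall x₀ ‖u - x₀‖).norm_image_sub_le_of_norm_fderiv_le (𝕜 := ℝ)
    (fun z _ => (hf.differentiable (by norm_num)) z) hb
    (Metric.mem_closedBall_self (norm_nonneg _)) (y := u) (by simp [dist_eq_norm])
  rw [Real.norm_eq_abs] at h
  nlinarith

/-- The elements of the space of a `C²` translation-invariant kernel are uniformly locally
Lipschitz, since `‖k(·,x) - k(·,y)‖² = 2 (κ(0) - κ(y - x)) = O(‖x - y‖²)`. No differentiability of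
`f` is needed: the partial derivative of a non-differentiable function is `0`. -/
lemma exists_abs_pderiv_le (hk : IsKernelOf H k) (hκ : ∀ x y, k x y = κ (x - y))
    (hκ2 : ContDiff ℝ 2 κ) :
    ∃ M : ℝ, 0 ≤ M ∧ ∀ (f : H) (j : Fin d) (x : Rd d), |pderiv j f x| ≤ M * ‖f‖ := by
  obtain ⟨C, hC0, hC⟩ := exists_abs_sub_le_sq_of_isLocalMax hκ2
    (Eventually.of_forall (le_apply_zero hk hκ) : IsLocalMax κ 0)
  refine ⟨√(2 * C), by positivity, fun f j x => ?_⟩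
  have key : ∀ᶠ z in 𝓝 x, ‖f z - f x‖ ≤ √(2 * C) * ‖f‖ * ‖z - x‖ := by
    have hT : Tendsto (fun z => x - z) (𝓝 x) (𝓝 0) := by
      have : Continuous fun z : Rd d => x - z := by fun_prop
      simpa using this.tendsto x
    filter_upwards [hT.eventually hC] with z hz
    have hn : ‖RKHS.kerFun H z (1 : ℝ) - RKHS.kerFun H x (1 : ℝ)‖ ≤ √(2 * C) * ‖z - x‖ := by
      refine abs_le_of_sq_le_sq' ?_ (by positivity) |>.2
      rw [norm_kerFun_one_sub_sq hk hκ, mul_pow, Real.sq_sqrt (by positivity), norm_sub_rev z x]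
      rw [sub_zero] at hz
      have := (neg_le_abs _).trans hz
      linarith
    rw [← inner_kerFun_one f z, ← inner_kerFun_one f x, ← inner_sub_right]
    calc _ ≤ ‖f‖ * ‖RKHS.kerFun H z (1 : ℝ) - RKHS.kerFun H x (1 : ℝ)‖ :=
          norm_inner_le_norm _ _
      _ ≤ ‖f‖ * (√(2 * C) * ‖z - x‖) := by gcongr
      _ = _ := by ring
  have h := norm_lineDeriv_le_of_lip' ℝ (v := EuclideanSpace.single j (1 : ℝ)) (by positivity) key
  simpa [pderiv] using h

lemma exists_abs_langevinStein_le (hk : IsKernelOf H k) (hκ : ∀ x y, k x y = κ (x - y))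
    (hκ2 : ContDiff ℝ 2 κ) {p₀ : Rd d → ℝ} {S : ℝ} (hS : ∀ j x, |score p₀ j x| ≤ S) :
    ∃ B : ℝ, 0 < B ∧ ∀ (f : PiLp 2 (fun _ : Fin d => H)), ‖f‖ ≤ 1 → ∀ x,
      |langevinStein p₀ f x| ≤ B := by
  obtain ⟨M, hM0, hM⟩ := exists_abs_pderiv_le hk hκ hκ2
  have hS' : ∀ j x, |score p₀ j x| ≤ |S| := fun j x => (hS j x).trans (le_abs_self S)
  refine ⟨d * (|S| * √(κ 0)) + d * M + 1, by positivity, fun f hf x => ?_⟩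
  have hfj : ∀ j, ‖f j‖ ≤ 1 := fun j => (PiLp.norm_apply_le f j).trans hf
  have h1 : |∑ j, score p₀ j x * f j x| ≤ d * (|S| * √(κ 0)) := by
    refine (Finset.abs_sum_le_sum_abs _ _).trans ?_
    refine (Finset.sum_le_card_nsmul _ _ (|S| * √(κ 0)) fun j _ => ?_).trans_eq (by simp)
    rw [abs_mul]
    have := abs_apply_le hk hκ (f j) x
    have h2 : ‖f j‖ * √(κ 0) ≤ √(κ 0) := mul_le_of_le_one_left (Real.sqrt_nonneg _) (hfj j)
    exact mul_le_mul (hS' j x) (this.trans h2) (abs_nonneg _) (abs_nonneg _)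
  have h2 : |∑ j, pderiv j (fun z => f j z) x| ≤ d * M := by
    refine (Finset.abs_sum_le_sum_abs _ _).trans ?_
    refine (Finset.sum_le_card_nsmul _ _ M fun j _ => ?_).trans_eq (by simp)
    exact (hM (f j) j x).trans (mul_le_of_le_one_right hM0 (hfj j))
  unfold langevinStein
  linarith [abs_add_le (∑ j, score p₀ j x * f j x) (∑ j, pderiv j (fun z => f j z) x)]

/-- By translation invariance the derivatives of the kernel in `K₀(x,x)` are constants, so
`K₀(x,x)` is bounded when the score is. -/
lemma exists_steinKernel_self_le (hκ : ∀ x y, k x y = κ (x - y)) {p₀ : Rd d → ℝ} {S : ℝ}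
    (hS : ∀ j x, |score p₀ j x| ≤ S) :
    ∃ B : ℝ, ∀ x, steinKernel k p₀ x x ≤ B := by
  have ha : ∀ j x, pderiv j (fun x' => k x' x) x = pderiv j (fun x' => k x' 0) 0 := by
    intro j x; simp [pderiv, lineDeriv, hκ]
  have hb : ∀ j x, pderiv j (fun y' => k x y') x = pderiv j (fun y' => k 0 y') 0 := by
    intro j x; simp [pderiv, lineDeriv, hκ]
  have hc : ∀ j x, pderiv j (fun x' => pderiv j (fun y' => k x' y') x) x
      = pderiv j (fun x' => pderiv j (fun y' => k x' y') 0) 0 := by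
    intro j x; simp [pderiv, lineDeriv, hκ]
  refine ⟨(∑ _j : Fin d, S * S) * |κ 0|
    + ∑ j, S * |pderiv j (fun x' => k x' 0) 0| + ∑ j, S * |pderiv j (fun y' => k 0 y') 0|
    + ∑ j, pderiv j (fun x' => pderiv j (fun y' => k x' y') 0) 0, fun x => ?_⟩
  have hmul : ∀ j (r : ℝ), score p₀ j x * r ≤ S * |r| := fun j r =>
    (le_abs_self _).trans (by rw [abs_mul]; gcongr; exact hS j x)
  have hss : ∀ j, score p₀ j x * score p₀ j x ≤ S * S := fun j =>
    (hmul j _).trans (mul_le_mul_of_nonneg_left (hS j x) ((abs_nonneg _).trans (hS j x)))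
  unfold steinKernel
  simp only [ha, hb, hc, hκ x x, sub_self]
  gcongr ?_ + ?_ + ?_ + _
  · refine (mul_le_mul_of_nonneg_left (le_abs_self _)
      (Finset.sum_nonneg fun j _ => mul_self_nonneg _)).trans ?_
    exact mul_le_mul_of_nonneg_right (Finset.sum_le_sum fun j _ => hss j) (abs_nonneg _)
  · exact Finset.sum_le_sum fun j _ => hmul j _
  · exact Finset.sum_le_sum fun j _ => hmul j _

lemma mem_samplingClass (hκ : ∀ x y, k x y = κ (x - y)) {p₀ : Rd d → ℝ} {S : ℝ}
    (hS : ∀ j x, |score p₀ j x| ≤ S) (P : Measure (Rd d)) [IsProbabilityMeasure P] :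
    P ∈ samplingClass k p₀ := by
  obtain ⟨B, hB⟩ := exists_steinKernel_self_le hκ hS
  refine ⟨inferInstance, ?_⟩
  calc ∫⁻ x, ENNReal.ofReal (√(steinKernel k p₀ x x)) ∂P
      ≤ ∫⁻ _, ENNReal.ofReal √B ∂P := by
        gcongr with x
        exact hB x
    _ < ⊤ := by simp

/-- A characteristic kernel does not vanish: otherwise all mean embeddings would be `0`. -/
lemma apply_zero_pos (hd : 0 < d) (hk : IsKernelOf H k) (hκ : ∀ x y, k x y = κ (x - y))
    (hchar : IsCharacteristic H (d := d)) : 0 < κ 0 := by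
  have h0 : 0 ≤ κ 0 := by rw [← norm_kerFun_one_sq hk hκ 0]; positivity
  refine lt_of_le_of_ne h0 fun h => ?_
  have hz : ∀ x, RKHS.kerFun H x (1 : ℝ) = 0 := fun x => by
    rw [← norm_eq_zero, norm_kerFun_one hk hκ, ← h, Real.sqrt_zero]
  have he : (0 : Rd d) ≠ EuclideanSpace.single ⟨0, hd⟩ 1 := fun h => by
    simpa using congrArg (fun v : Rd d => v ⟨0, hd⟩) h
  exact he (dirac_eq_dirac_iff.1
    (hchar (.dirac 0) (.dirac _) inferInstance inferInstance (by simp [hz])))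

end Translation

/-! ### A target with bounded score -/

section Target

variable {d : ℕ}

lemma score_eq {p : Rd d → ℝ} (hp : ContDiff ℝ 1 p) (hpos : ∀ x, 0 < p x) (j : Fin d) (x : Rd d) :
    score p j x = fderiv ℝ p x (EuclideanSpace.single j 1) / p x := by
  have h := ((hp.differentiable one_ne_zero x).hasFDerivAt.log (hpos x).ne').hasLineDerivAt
    (EuclideanSpace.single j (1 : ℝ))
  rw [score, pderiv, h.lineDeriv]
  simp [div_eq_inv_mul]

lemma pderiv_eq {f : Rd d → ℝ} (hf : ContDiff ℝ 1 f) (j : Fin d) (x : Rd d) :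
    pderiv j f x = fderiv ℝ f x (EuclideanSpace.single j 1) :=
  (hf.differentiable one_ne_zero x).lineDeriv_eq_fderiv

/-- If `(∂_j ln p) h + ∂_j h` is a constant `C`, then `∂_j (h p) = C p` has constant sign, so that
`h p` is monotone along the lines in direction `e_j`; as it vanishes at both ends, `h = 0`. -/
lemma eq_zero_of_stein_const {p h : Rd d → ℝ} (hp : ContDiff ℝ 1 p) (hpos : ∀ x, 0 < p x)
    (hh : ContDiff ℝ 1 h)
    (hlim : Tendsto (fun x => h x * p x) (Bornology.cobounded (Rd d)) (𝓝 0)) (j : Fin d) {C : ℝ}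
    (hC : ∀ x, score p j x * h x + pderiv j h x = C) (x : Rd d) : h x = 0 := by
  set e : Rd d := EuclideanSpace.single j 1 with he
  have hd' : ∀ t : ℝ, HasDerivAt (fun t : ℝ => h (x + t • e) * p (x + t • e))
      (C * p (x + t • e)) t := by
    intro t
    have hl : HasDerivAt (fun t : ℝ => x + t • e) e t := by
      simpa using ((hasDerivAt_id t).smul_const e).const_add x
    have h1 := (hh.differentiable one_ne_zero (x + t • e)).hasFDerivAt.comp_hasDerivAt t hl
    have h2 := (hp.differentiable one_ne_zero (x + t • e)).hasFDerivAt.comp_hasDerivAt t hl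
    refine (h1.mul h2).congr_deriv ?_
    rw [← hC (x + t • e), score_eq hp hpos, pderiv_eq hh]
    have := (hpos (x + t • e)).ne'
    simp only [Function.comp_apply]
    field_simp
    ring
  have hdiff : Differentiable ℝ (fun t : ℝ => h (x + t • e) * p (x + t • e)) :=
    fun t => (hd' t).differentiableAt
  have hco : ∀ l : Filter ℝ, Tendsto (fun t : ℝ => |t|) l atTop →
      Tendsto (fun t : ℝ => h (x + t • e) * p (x + t • e)) l (𝓝 0) := by
    intro l hl
    refine hlim.comp ?_
    rw [← tendsto_norm_atTop_iff_cobounded]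
    refine tendsto_atTop_mono (fun t => ?_) (tendsto_atTop_add_const_right l (-‖x‖) hl)
    have := norm_sub_norm_le (t • e) (-x)
    rw [sub_neg_eq_add, norm_neg, norm_smul, he, PiLp.norm_single, norm_one, mul_one,
      Real.norm_eq_abs, add_comm _ x] at this
    linarith
  have htop := hco _ tendsto_abs_atTop_atTop
  have hbot := hco _ tendsto_abs_atBot_atTop
  have hz : h (x + (0 : ℝ) • e) * p (x + (0 : ℝ) • e) = 0 := by
    rcases le_total 0 C with hC0 | hC0
    · have hm : Monotone (fun t : ℝ => h (x + t • e) * p (x + t • e)) :=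
        monotone_of_deriv_nonneg hdiff fun t => by
          rw [(hd' t).deriv]; exact mul_nonneg hC0 (hpos _).le
      exact le_antisymm (hm.ge_of_tendsto htop 0) (hm.le_of_tendsto hbot 0)
    · have hm : Antitone (fun t : ℝ => h (x + t • e) * p (x + t • e)) :=
        antitone_of_deriv_nonpos hdiff fun t => by
          rw [(hd' t).deriv]; exact mul_nonpos_of_nonpos_of_nonneg hC0 (hpos _).le
      exact le_antisymm (hm.ge_of_tendsto hbot 0) (hm.le_of_tendsto htop 0)
  rw [zero_smul, add_zero] at hz
  exact (mul_eq_zero.1 hz).resolve_right (hpos x).ne'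

/-- The probability density on `ℝ^d` proportional to `(1 + ‖x‖²)^(-d)`. Its tails are polynomial,
which makes the score bounded. -/
noncomputable def cauchyDensity (d : ℕ) (x : Rd d) : ℝ :=
  (∫ y : Rd d, ((1 + ‖y‖ ^ 2) ^ d)⁻¹)⁻¹ * ((1 + ‖x‖ ^ 2) ^ d)⁻¹

lemma integrable_inv_one_add_norm_sq_pow (hd : 0 < d) :
    Integrable (fun x : Rd d => ((1 + ‖x‖ ^ 2) ^ d)⁻¹) := by
  have h : (Module.finrank ℝ (Rd d) : ℝ) < 2 * d := by
    have : (0 : ℝ) < d := by exact_mod_cast hd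
    simp only [finrank_euclideanSpace, Fintype.card_fin]
    linarith
  refine (integrable_rpow_neg_one_add_norm_sq (μ := (volume : Measure (Rd d))) h).congr
    (Eventually.of_forall fun x => ?_)
  simp only
  rw [show -(2 * (d : ℝ)) / 2 = -(d : ℝ) by ring, Real.rpow_neg (by positivity), Real.rpow_natCast]

lemma integral_inv_one_add_norm_sq_pow_pos (hd : 0 < d) :
    0 < ∫ x : Rd d, ((1 + ‖x‖ ^ 2) ^ d)⁻¹ := by
  rw [integral_pos_iff_support_of_nonneg (fun x => by positivity)
    (integrable_inv_one_add_norm_sq_pow hd)]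
  have : Function.support (fun x : Rd d => ((1 + ‖x‖ ^ 2) ^ d)⁻¹) = Set.univ :=
    Set.eq_univ_of_forall fun x => by
      rw [Function.mem_support]; positivity
  rw [this]
  exact Measure.measure_univ_pos.2 (NeZero.ne _)

lemma integrable_cauchyDensity (hd : 0 < d) : Integrable (cauchyDensity d) :=
  (integrable_inv_one_add_norm_sq_pow hd).const_mul _

lemma cauchyDensity_pos (hd : 0 < d) (x : Rd d) : 0 < cauchyDensity d x :=
  mul_pos (inv_pos.2 (integral_inv_one_add_norm_sq_pow_pos hd)) (by positivity)

lemma contDiff_cauchyDensity : ContDiff ℝ 1 (cauchyDensity d) := by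
  refine contDiff_const.mul (ContDiff.inv ?_ fun x => by positivity)
  exact (contDiff_const.add (contDiff_id.norm_sq ℝ)).pow d

lemma abs_score_cauchyDensity_le (hd : 0 < d) (j : Fin d) (x : Rd d) :
    |score (cauchyDensity d) j x| ≤ d := by
  have hZ := integral_inv_one_add_norm_sq_pow_pos hd
  have hlog : (fun z => Real.log (cauchyDensity d z)) = fun z =>
      Real.log (∫ y : Rd d, ((1 + ‖y‖ ^ 2) ^ d)⁻¹)⁻¹ - d * Real.log (1 + ‖z‖ ^ 2) := by
    funext z
    rw [cauchyDensity, Real.log_mul (inv_pos.2 hZ).ne' (by positivity), Real.log_inv ((_) ^ d),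
      Real.log_pow]
    ring
  have h1 : HasFDerivAt (fun z : Rd d => 1 + ‖z‖ ^ 2) (2 • innerSL ℝ x) x :=
    (hasStrictFDerivAt_norm_sq x).hasFDerivAt.const_add 1
  have h2 := (((h1.log (by positivity)).const_mul (d : ℝ)).const_sub
    (Real.log (∫ y : Rd d, ((1 + ‖y‖ ^ 2) ^ d)⁻¹)⁻¹)).hasLineDerivAt
      (EuclideanSpace.single j (1 : ℝ))
  rw [score, pderiv, hlog, h2.lineDeriv]
  have hx : |x j| ≤ ‖x‖ := by simpa using PiLp.norm_apply_le x j
  have hin : inner ℝ x (EuclideanSpace.single j (1 : ℝ)) = x j := by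
    simp [EuclideanSpace.inner_single_right]
  simp only [neg_apply, smul_apply, innerSL_apply_apply, hin,
    smul_eq_mul, nsmul_eq_mul, abs_neg, abs_mul]
  rw [abs_of_nonneg (Nat.cast_nonneg d), abs_of_pos (by positivity : 0 < (1 + ‖x‖ ^ 2)⁻¹)]
  refine mul_le_of_le_one_right (Nat.cast_nonneg d) ?_
  rw [inv_mul_le_one₀ (by positivity)]
  norm_num
  nlinarith [sq_nonneg (‖x‖ - 1)]

lemma tendsto_cauchyDensity (hd : 0 < d) :
    Tendsto (cauchyDensity d) (Bornology.cobounded (Rd d)) (𝓝 0) := by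
  have h1 : Tendsto (fun x : Rd d => (1 + ‖x‖ ^ 2) ^ d) (Bornology.cobounded (Rd d)) atTop :=
    (tendsto_pow_atTop hd.ne').comp (tendsto_atTop_add_const_left _ 1
      ((tendsto_pow_atTop two_ne_zero).comp tendsto_norm_cobounded_atTop))
  unfold cauchyDensity
  simpa using h1.inv_tendsto_atTop.const_mul
    (∫ y : Rd d, ((1 + ‖y‖ ^ 2) ^ d)⁻¹)⁻¹

lemma isTarget_cauchyDensity (hd : 0 < d) {H : Type*} [NormedAddCommGroup H]
    [InnerProductSpace ℝ H] [RKHS ℝ H (Rd d) ℝ] {C : ℝ}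
    (hb : ∀ (h : H) (x : Rd d), |h x| ≤ ‖h‖ * C) :
    IsTarget H ((volume : Measure (Rd d)).withDensity fun x => ENNReal.ofReal (cauchyDensity d x))
      (cauchyDensity d) where
  isProb := by
    constructor
    rw [withDensity_apply _ MeasurableSet.univ, Measure.restrict_univ,
      ← ofReal_integral_eq_lintegral_ofReal (integrable_cauchyDensity hd)
        (Eventually.of_forall fun x => (cauchyDensity_pos hd x).le)]
    simp only [cauchyDensity]
    rw [integral_const_mul, inv_mul_cancel₀ (integral_inv_one_add_norm_sq_pow_pos hd).ne',
      ENNReal.ofReal_one]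
  density := rfl
  contDiff := contDiff_cauchyDensity
  pos := cauchyDensity_pos hd
  vanish h := by
    refine squeeze_zero_norm (fun x => ?_)
      (by simpa using (tendsto_cauchyDensity hd).const_mul (‖h‖ * C))
    rw [norm_mul, Real.norm_eq_abs, Real.norm_of_nonneg (cauchyDensity_pos hd x).le]
    exact mul_le_mul_of_nonneg_right (hb h x) (cauchyDensity_pos hd x).le

end Target

/-! ### The lower bound -/

section LowerBound

variable {d : ℕ} {H : Type*} [NormedAddCommGroup H] [InnerProductSpace ℝ H] [CompleteSpace H]
  [RKHS ℝ H (Rd d) ℝ] {k : Rd d → Rd d → ℝ} {κ : Rd d → ℝ}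

/-- For the field `f = ‖k(·,0)‖⁻¹ k(·,0) e_j` the function `A_{p₀} f` is continuous and not
constant. -/
lemma exists_langevinStein_nonconst (hd : 0 < d) (hk : IsKernelOf H k)
    (hκ : ∀ x y, k x y = κ (x - y)) (hκ2 : ContDiff ℝ 2 κ) (hκ0 : 0 < κ 0) {P₀ : Measure (Rd d)}
    {p₀ : Rd d → ℝ} (hP : IsTarget H P₀ p₀) :
    ∃ f : PiLp 2 (fun _ : Fin d => H), ‖f‖ ≤ 1 ∧ Continuous (langevinStein p₀ f) ∧
      ∀ C, ∃ x, langevinStein p₀ f x ≠ C := by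
  set h : H := (√(κ 0))⁻¹ • RKHS.kerFun H 0 (1 : ℝ) with hh
  have hhx : ⇑h = fun x => (√(κ 0))⁻¹ * κ x := by
    funext x; simp [hh, hk x 0, hκ]
  have hhC : ContDiff ℝ 1 h := by
    rw [hhx]; exact contDiff_const.mul (hκ2.of_le (by norm_num))
  set j : Fin d := ⟨0, hd⟩
  have hA : langevinStein p₀ (PiLp.single 2 j h) = fun x => score p₀ j x * h x + pderiv j h x := by
    funext x
    unfold langevinStein
    congr 1
    · rw [Finset.sum_eq_single j] <;> simp +contextual
    · rw [Finset.sum_eq_single j]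
      · simp
      · intro i _ hij
        simp [hij, pderiv, lineDeriv]
      · simp
  refine ⟨PiLp.single 2 j h, ?_, ?_, fun C => ?_⟩
  · rw [PiLp.norm_single, hh, norm_smul, norm_kerFun_one hk hκ, Real.norm_eq_abs,
      abs_of_pos (by positivity), inv_mul_cancel₀ (by positivity)]
  · rw [hA]
    simp only [score_eq hP.contDiff hP.pos, pderiv_eq hhC]
    have h1 := hP.contDiff.continuous_fderiv one_ne_zero
    have h2 := hhC.continuous_fderiv one_ne_zero
    exact (((h1.clm_apply continuous_const).div hP.contDiff.continuous
      fun x => (hP.pos x).ne').mul hhC.continuous).add (h2.clm_apply continuous_const)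
  · by_contra! hC
    have := eq_zero_of_stein_const hP.contDiff hP.pos hhC (hP.vanish h) j
      (C := C) (fun x => by rw [← hC x, hA]) 0
    rw [hhx] at this
    have hpos : 0 < (√(κ 0))⁻¹ * κ 0 := by positivity
    exact hpos.ne' this

/-- A perturbation direction along which the discrepancy from `P₀` grows linearly: `g` is the
centred and rescaled function `A_{p₀} f`, so that `∫ g · A_{p₀} f dP₀` is a multiple of the
variance of `A_{p₀} f` under `P₀`. -/
lemma exists_direction {P₀ : Measure (Rd d)} [IsProbabilityMeasure P₀] (hac : volume ≪ P₀)
    {a : Rd d → ℝ} (ha : Continuous a) {B : ℝ} (hB : 0 < B) (haB : ∀ x, |a x| ≤ B)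
    (hne : ∀ C, ∃ x, a x ≠ C) :
    ∃ g : Rd d → ℝ, Measurable g ∧ (∀ x, |g x| ≤ 1) ∧ ∫ x, g x ∂P₀ = 0 ∧
      0 < ∫ x, g x * a x ∂P₀ := by
  have hi : Integrable a P₀ := integrable_of_abs_le ha.measurable haB
  set m := ∫ x, a x ∂P₀ with hm
  have hmB : |m| ≤ B := by
    simpa using norm_integral_le_of_norm_le (μ := P₀) (f := a)
      (integrable_const B) (Eventually.of_forall haB)
  have hg1 : ∀ x, |(a x - m) / (2 * B)| ≤ 1 := fun x => by
    rw [abs_div, abs_of_pos (by positivity : 0 < 2 * B), div_le_one (by positivity)]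
    linarith [abs_sub (a x) m, haB x]
  have hgm : Measurable fun x => (a x - m) / (2 * B) :=
    (ha.measurable.sub_const m).div_const _
  have hg0 : ∫ x, (a x - m) / (2 * B) ∂P₀ = 0 := by
    rw [integral_div, integral_sub hi (integrable_const m)]
    simp [← hm]
  refine ⟨fun x => (a x - m) / (2 * B), hgm, hg1, hg0, ?_⟩
  have hgi : Integrable (fun x => (a x - m) / (2 * B)) P₀ := integrable_of_abs_le hgm hg1
  have hsq : ∀ x, (a x - m) / (2 * B) * a x - m * ((a x - m) / (2 * B))
      = (a x - m) ^ 2 / (2 * B) := fun x => by ring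
  have hga : Integrable (fun x => (a x - m) / (2 * B) * a x) P₀ :=
    hi.bdd_mul hgm.aestronglyMeasurable (Eventually.of_forall hg1)
  have hsqi : Integrable (fun x => (a x - m) ^ 2 / (2 * B)) P₀ := by
    simp_rw [← hsq]; exact hga.sub (hgi.const_mul m)
  have heq : ∫ x, (a x - m) / (2 * B) * a x ∂P₀ = ∫ x, (a x - m) ^ 2 / (2 * B) ∂P₀ := by
    simp_rw [← hsq]
    rw [integral_sub hga (hgi.const_mul m), integral_const_mul, hg0, mul_zero, sub_zero]
  rw [heq]
  refine lt_of_le_of_ne (integral_nonneg fun x => by positivity) fun h0 => ?_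
  have hae := (integral_eq_zero_iff_of_nonneg (fun x => by positivity) hsqi).1 h0.symm
  have hae' : a =ᵐ[volume] fun _ => m := by
    filter_upwards [hac.ae_le hae] with x hx
    simpa [hB.ne', sub_eq_zero] using hx
  obtain ⟨x, hx⟩ := hne m
  exact hx (congrFun ((ha.ae_eq_iff_eq volume continuous_const).1 hae') x)

/-- Every estimator errs by at least `c / √n` with probability at least `1/4` for some admissible
pair `(P₀, P)`. -/
theorem exists_quarter_le_error (hd : 0 < d) (hk : IsKernelOf H k)
    (hC2 : ContDiff ℝ 2 (fun z : Rd d × Rd d => k z.1 z.2)) (htrans : IsTranslationInvariant k)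
    (hchar : IsCharacteristic H (d := d)) :
    ∃ c : ℝ, 0 < c ∧ ∃ (P₀ : Measure (Rd d)) (p₀ : Rd d → ℝ), IsTarget H P₀ p₀ ∧
      ∀ n : ℕ, 0 < n → ∀ F : (Fin n → Rd d) → ℝ, Measurable F →
        ∃ P ∈ samplingClass k p₀,
          1 / 4 ≤ (Measure.pi fun _ : Fin n => P) {X | c / √(n : ℝ) ≤ |F X - ksd H P₀ p₀ P|} := by
  obtain ⟨κ, hκ⟩ := htrans
  have hκ2 : ContDiff ℝ 2 κ := contDiff_of_kernel (m := 2) hC2 hκ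
  have hκ0 := apply_zero_pos hd hk hκ hchar
  set p₀ := cauchyDensity d
  set P₀ := (volume : Measure (Rd d)).withDensity fun x => ENNReal.ofReal (p₀ x) with hP₀
  have hT : IsTarget H P₀ p₀ := isTarget_cauchyDensity hd (abs_apply_le hk hκ)
  have := hT.isProb
  have hS := abs_score_cauchyDensity_le hd
  obtain ⟨B, hB0, hB⟩ := exists_abs_langevinStein_le hk hκ hκ2 hS
  obtain ⟨f, hf, hfc, hfne⟩ := exists_langevinStein_nonconst hd hk hκ hκ2 hκ0 hT
  have hac : volume ≪ P₀ :=
    withDensity_absolutelyContinuous' (by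
      exact (hT.contDiff.continuous.measurable.ennreal_ofReal).aemeasurable)
      (Eventually.of_forall fun x => by simpa using hT.pos x)
  obtain ⟨g, hg, hg1, hg0, hgpos⟩ := exists_direction hac hfc hB0 (hB f hf) hfne
  set δ := ∫ x, g x * langevinStein p₀ f x ∂P₀
  refine ⟨δ / 6, by positivity, P₀, p₀, hT, fun n hn F hF => ?_⟩
  have hn0 : (0 : ℝ) < n := by exact_mod_cast hn
  have hn1 : 1 ≤ √(n : ℝ) := Real.one_le_sqrt.2 (by exact_mod_cast hn)
  -- With `ε = 1 / (3 √n)` the two-point bound applies, as `n ε² = 1/9`.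
  set ε : ℝ := 1 / (3 * √(n : ℝ)) with hε
  have hε0 : 0 ≤ ε := by positivity
  have hε1 : ε ≤ 1 := by rw [hε, div_le_one (by positivity)]; linarith
  have hnε : n * ε ^ 2 ≤ 1 / 9 := by
    rw [hε, div_pow, mul_pow, Real.sq_sqrt hn0.le]
    apply le_of_eq
    field_simp
    norm_num
  have := isProbabilityMeasure_tilt hg hg1 hg0 hε0 hε1
  have hksd : ε * δ ≤ ksd H P₀ p₀ (tilt P₀ g ε) := by
    refine le_trans ?_ (le_ciSup (bddAbove_range_ksd hB P₀ (tilt P₀ g ε)) ⟨f, hf⟩)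
    rw [integral_tilt hg hg1 hε0 hε1 hfc.measurable (hB f hf), sub_add_cancel_left, abs_neg]
    exact le_abs_self _
  have hs : ε * δ = 2 * (δ / 6 / √(n : ℝ)) := by rw [hε]; field_simp; norm_num
  set s := δ / 6 / √(n : ℝ)
  by_cases hS4 : 1 / 4 ≤ (Measure.pi fun _ : Fin n => P₀) {X | s ≤ |F X|}
  · exact ⟨P₀, mem_samplingClass hκ hS P₀, by simpa [ksd_self] using hS4⟩
  · refine ⟨tilt P₀ g ε, mem_samplingClass hκ hS _, ?_⟩
    have hmeas : MeasurableSet {X | s ≤ |F X|} :=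
      measurableSet_le measurable_const hF.abs
    refine (quarter_le_pi_tilt_compl hg hg1 hg0 hε0 hε1 hnε hmeas (not_le.1 hS4).le).trans
      (measure_mono fun X hX => ?_)
    have hX' : |F X| < s := not_le.1 hX
    change s ≤ |F X - ksd H P₀ p₀ (tilt P₀ g ε)|
    have := (le_abs_self (F X)).trans_lt hX'
    have h2 := neg_le_abs (F X - ksd H P₀ p₀ (tilt P₀ g ε))
    linarith

end LowerBound

end SteinDisc

theorem theorem1 {d : ℕ} (hd : 0 < d)
    (H : Type*) [NormedAddCommGroup H] [InnerProductSpace ℝ H] [CompleteSpace H]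
    [RKHS ℝ H (SteinDisc.Rd d) ℝ]
    (k : SteinDisc.Rd d → SteinDisc.Rd d → ℝ)
    (hk : SteinDisc.IsKernelOf H k)
    (hC2 : ContDiff ℝ 2 (fun z : SteinDisc.Rd d × SteinDisc.Rd d => k z.1 z.2))
    (hbdd : SteinDisc.IsBoundedKernel k)
    (htrans : SteinDisc.IsTranslationInvariant k)
    (hchar : SteinDisc.IsCharacteristic H) :
    ∃ c : ℝ, 0 < c ∧ ∀ n : ℕ, 0 < n →
      1 / 4 ≤ SteinDisc.minimaxProb H k n (c / √(n : ℝ)) ∧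
      ENNReal.ofReal (c / √(n : ℝ)) / 4 ≤ SteinDisc.minimaxRisk H k n := by
  obtain ⟨c, hc, P₀, p₀, hT, h⟩ :=
    SteinDisc.exists_quarter_le_error hd hk hC2 htrans hchar
  refine ⟨c, hc, fun n hn => ⟨le_iInf₂ fun F hF => ?_, le_iInf₂ fun F hF => ?_⟩⟩
  · obtain ⟨P, hP, hle⟩ := h n hn F hF
    exact hle.trans (le_iSup_of_le P₀ (le_iSup_of_le p₀ (le_iSup_of_le hT
      (le_iSup_of_le P (le_iSup_of_le hP le_rfl)))))
  · obtain ⟨P, hP, hle⟩ := h n hn F hF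
    refine le_trans ?_ (le_iSup_of_le P₀ (le_iSup_of_le p₀ (le_iSup_of_le hT
      (le_iSup_of_le P (le_iSup_of_le hP le_rfl)))))
    -- Markov's inequality turns the bound in probability into one on the risk.
    have hm : Measurable fun X => ENNReal.ofReal |F X - SteinDisc.ksd H P₀ p₀ P| :=
      (hF.sub_const _).abs.ennreal_ofReal
    refine le_trans ?_ (mul_meas_ge_le_lintegral hm (ENNReal.ofReal (c / √(n : ℝ))))
    rw [div_eq_mul_one_div]
    gcongr
    refine hle.trans (measure_mono fun X hX => ?_)
    exact ENNReal.ofReal_le_ofReal hX
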